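/- Let $\Omega\subset\mathbb{R}^2$ be a convex domain (a nonempty, bounded, open, convex set) which has two axes of symmetry forming an angle $\theta=\pi/N$, where $N\ge 5$ is an integer. Let $P(\Omega)=\mathcal{H}^1(\partial\Omega)$ be its perimeter (which is finite), and let $$\mu_1(\Omega)=\inf\left\{\frac{\int_\Omega|\nabla u|^2\,dx}{\int_\Omega u^2\,dx}\;:\;u\in H^1(\Omega),\ u\neq 0,\ \int_\Omega u\,dx=0\right\}$$ be the first nontrivial eigenvalue of the Neumann Laplacian on $\Omega$. Then $$P(\Omega)^2\,\mu_1(\Omega)<16\pi^2 .$$ -/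

import Mathlib

open MeasureTheory
open scoped ContDiff

noncomputable section

/-- The Euclidean plane. -/
abbrev Plane : Type := EuclideanSpace ℝ (Fin 2)

/-- A planar convex domain: a nonempty bounded open convex subset of the plane. -/
structure IsConvexDomain (Ω : Set Plane) : Prop where
  nonempty : Ω.Nonempty
  isOpen : IsOpen Ω
  bounded : Bornology.IsBounded Ω
  convex : Convex ℝ Ω

/-- The line `L` is an axis of symmetry of `Ω`: the orthogonal reflection across `L` maps `Ω`
onto itself. -/
def IsSymmetryAxis (L : AffineSubspace ℝ Plane) (Ω : Set Plane) : Prop :=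
  Module.finrank ℝ L.direction = 1 ∧
    ∃ _ : Nonempty L, EuclideanGeometry.reflection L '' Ω = Ω

/-- The lines `L₁` and `L₂` form the (undirected) angle `θ`: they have direction vectors with
angle `θ`. -/
def LinesFormAngle (L₁ L₂ : AffineSubspace ℝ Plane) (θ : ℝ) : Prop :=
  ∃ v ∈ L₁.direction, ∃ w ∈ L₂.direction,
    v ≠ 0 ∧ w ≠ 0 ∧ InnerProductGeometry.angle v w = θ

/-- The boundary length of `Ω`, i.e. the one-dimensional Hausdorff measure of `∂Ω`. -/
def boundaryLength (Ω : Set Plane) : ENNReal :=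
  Measure.hausdorffMeasure 1 (frontier Ω)

/-- The perimeter `P(Ω)` as a real number. -/
def perimeter (Ω : Set Plane) : ℝ := (boundaryLength Ω).toReal

/-- `g` is the weak gradient of `u` in `Ω`, tested against smooth functions with compact support
in `Ω`. -/
def HasWeakGradient (Ω : Set Plane) (u : Plane → ℝ) (g : Plane → Plane) : Prop :=
  ∀ φ : Plane → ℝ, ContDiff ℝ ∞ φ → HasCompactSupport φ → tsupport φ ⊆ Ω →
    ∫ x in Ω, u x • gradient φ x = -∫ x in Ω, φ x • g x

/-- `u` belongs to the Sobolev space `H¹(Ω)`, with weak gradient `g`. -/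
structure IsH1 (Ω : Set Plane) (u : Plane → ℝ) (g : Plane → Plane) : Prop where
  memLp : MemLp u 2 (volume.restrict Ω)
  memLp_grad : MemLp g 2 (volume.restrict Ω)
  hasWeakGradient : HasWeakGradient Ω u g

/-- The values of the Rayleigh quotient `∫ |∇u|² / ∫ u²` over all nonzero `u ∈ H¹(Ω)` with mean
zero. -/
def neumannRayleighValues (Ω : Set Plane) : Set ℝ :=
  {r | ∃ (u : Plane → ℝ) (g : Plane → Plane), IsH1 Ω u g ∧ ∫ x in Ω, u x = 0 ∧
    0 < ∫ x in Ω, u x ^ 2 ∧ r = (∫ x in Ω, ‖g x‖ ^ 2) / ∫ x in Ω, u x ^ 2}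

/-- The first nontrivial Neumann eigenvalue `μ₁(Ω)` of the Laplacian, by its variational
characterization. -/
def neumannMu1 (Ω : Set Plane) : ℝ := sInf (neumannRayleighValues Ω)

end

/-!
Let `c` be the intersection of the two axes, `r` the distance from `c` to the complement of `Ω`,
`A` the area and `P` the perimeter of `Ω`. The two reflections generate a rotation of angle
`2π / N` about `c`, and the theorem follows from three inequalities.

* `boundaryLength_le`: `P ≤ 2 A / r`, because `Ω` is convex and contains the disk of radius `r`
  about `c`. A narrow sector with apex `c` meets `∂Ω` in a set whose diameter is at most about
  `2 / r` times the area of `Ω` in the sector: a chord of `∂Ω` inside the sector has almost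
  distance `r` from `c`, and the triangle it spans with `c` lies in `Ω`. Covers by such sectors
  control the Hausdorff measure.
* `RotationInvariant.volume_le`: `A ≤ N tan(π / N) r²`. The support line at the boundary point
  nearest to `c`, together with its rotated copies, shows that `Ω` is contained in the regular
  `N`-gon circumscribed about the disk of radius `r`.
* `neumannMu1_le`: `μ₁ ≤ (332 / 97) π / A`, a slightly weaker form of the Szegő–Weinberger
  inequality. With `π R² = A` and `ρ` the distance to `c`, the test functions are the two
  coordinates of the field `(1 - (2 / 7) ρ² / R²) (x - c)`, which approximates Weinberger's Bessel
  profile. They have mean zero because of the two reflections. The sums of their squares and of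
  their squared gradients are radial, and transplanting mass to the disk of radius `R`
  (`setIntegral_defect_nonpos`) bounds the quotient by its value on this disk. Since a polynomial
  profile is not monotone for large `ρ`, this uses that `Ω` lies in the disk of radius
  `r / cos(π / N)`.

Together, `P² μ₁ ≤ 4 A² μ₁ / r² ≤ 4π (332 / 97) N tan(π / N)`, and the last quantity is below `16π²`
for `N ≥ 5` (`natCast_mul_tan_lt`), with a margin of about one percent for `N = 5`.
-/

open MeasureTheory
open scoped ContDiff

/-! ### Polar coordinates and triangles in the plane -/

/-- The unit vector of direction angle `θ`. -/
noncomputable def unitVec (θ : ℝ) : Plane := !₂[Real.cos θ, Real.sin θ]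

@[simp] lemma unitVec_zero (θ : ℝ) : unitVec θ 0 = Real.cos θ := rfl

@[simp] lemma unitVec_one (θ : ℝ) : unitVec θ 1 = Real.sin θ := rfl

lemma Plane.inner_eq (x y : Plane) : inner ℝ x y = x 0 * y 0 + x 1 * y 1 := by
  simp [PiLp.inner_apply, Fin.sum_univ_two, mul_comm]

lemma Plane.norm_sq_eq (x : Plane) : ‖x‖ ^ 2 = x 0 ^ 2 + x 1 ^ 2 := by
  simp [EuclideanSpace.norm_sq_eq, Fin.sum_univ_two]

lemma Plane.ext {x y : Plane} (h₀ : x 0 = y 0) (h₁ : x 1 = y 1) : x = y := by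
  ext i
  fin_cases i
  · exact h₀
  · exact h₁

@[simp] lemma norm_unitVec (θ : ℝ) : ‖unitVec θ‖ = 1 := by
  have h := Plane.norm_sq_eq (unitVec θ)
  rw [unitVec_zero, unitVec_one, Real.cos_sq_add_sin_sq] at h
  nlinarith [norm_nonneg (unitVec θ)]

lemma unitVec_add_int_mul_two_pi (θ : ℝ) (k : ℤ) :
    unitVec (θ + k * (2 * Real.pi)) = unitVec θ :=
  Plane.ext (by simp [Real.cos_add_int_mul_two_pi]) (by simp [Real.sin_add_int_mul_two_pi])

lemma exists_eq_norm_smul_unitVec (x : Plane) : ∃ θ : ℝ, x = ‖x‖ • unitVec θ := by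
  set z : ℂ := ⟨x 0, x 1⟩ with hz
  have hn : ‖z‖ = ‖x‖ := by
    rw [← sq_eq_sq₀ (norm_nonneg _) (norm_nonneg _), Plane.norm_sq_eq, Complex.sq_norm,
      Complex.normSq_apply]
    simp [hz, sq]
  refine ⟨z.arg, Plane.ext ?_ ?_⟩
  · simp [← hn, hz]
  · simp [← hn, hz]

/-- A direction angle can be chosen in any prescribed half-open interval of length `2π`. -/
lemma exists_eq_norm_smul_unitVec_mem_Ico (a : ℝ) (x : Plane) :
    ∃ θ ∈ Set.Ico a (a + 2 * Real.pi), x = ‖x‖ • unitVec θ := by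
  obtain ⟨θ, hθ⟩ := exists_eq_norm_smul_unitVec x
  refine ⟨toIcoMod Real.two_pi_pos a θ, toIcoMod_mem_Ico _ _ _, ?_⟩
  conv_lhs => rw [hθ, ← toIcoMod_add_toIcoDiv_zsmul Real.two_pi_pos a θ]
  rw [zsmul_eq_mul, unitVec_add_int_mul_two_pi]

/-- The signed area of the parallelogram spanned by two vectors. -/
def cross (p q : Plane) : ℝ := p 0 * q 1 - p 1 * q 0

@[simp] lemma cross_add_left (p q r : Plane) : cross (p + q) r = cross p r + cross q r := by
  simp [cross]; ring

@[simp] lemma cross_add_right (p q r : Plane) : cross p (q + r) = cross p q + cross p r := by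
  simp [cross]; ring

@[simp] lemma cross_smul_left (c : ℝ) (p q : Plane) : cross (c • p) q = c * cross p q := by
  simp [cross]; ring

@[simp] lemma cross_smul_right (c : ℝ) (p q : Plane) : cross p (c • q) = c * cross p q := by
  simp [cross]; ring

@[simp] lemma cross_unitVec (a b : ℝ) : cross (unitVec a) (unitVec b) = Real.sin (b - a) := by
  simp [cross, Real.sin_sub]; ring

@[simp] lemma inner_unitVec (a b : ℝ) : inner ℝ (unitVec a) (unitVec b) = Real.cos (b - a) := by
  simp [Plane.inner_eq, Real.cos_sub]; ring

/-- The closed triangle with vertices `0`, `p` and `q`. -/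
def triangle (p q : Plane) : Set Plane :=
  {z | ∃ s t : ℝ, 0 ≤ s ∧ 0 ≤ t ∧ s + t ≤ 1 ∧ z = s • p + t • q}

lemma volume_prod_standard_triangle :
    volume {z : ℝ × ℝ | 0 ≤ z.1 ∧ 0 ≤ z.2 ∧ z.1 + z.2 ≤ 1} = ENNReal.ofReal (1 / 2) := by
  have hm : MeasurableSet {z : ℝ × ℝ | 0 ≤ z.1 ∧ 0 ≤ z.2 ∧ z.1 + z.2 ≤ 1} := by
    apply IsClosed.measurableSet
    exact (isClosed_le continuous_const continuous_fst).inter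
      ((isClosed_le continuous_const continuous_snd).inter
        (isClosed_le (continuous_fst.add continuous_snd) continuous_const))
  rw [Measure.volume_eq_prod, Measure.prod_apply hm]
  have hsec (x : ℝ) : volume (Prod.mk x ⁻¹' {z : ℝ × ℝ | 0 ≤ z.1 ∧ 0 ≤ z.2 ∧ z.1 + z.2 ≤ 1}) =
      (Set.Icc (0 : ℝ) 1).indicator (fun x => ENNReal.ofReal (1 - x)) x := by
    by_cases hx : x ∈ Set.Icc (0 : ℝ) 1
    · rw [Set.indicator_of_mem hx, ← sub_zero (1 - x), ← Real.volume_Icc]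
      congr 1
      ext y
      simp only [Set.mem_preimage, Set.mem_ofPred_eq, Set.mem_Icc]
      constructor
      · rintro ⟨_, h, h'⟩; exact ⟨h, by linarith⟩
      · rintro ⟨h, h'⟩; exact ⟨hx.1, h, by linarith⟩
    · rw [Set.indicator_of_notMem hx]
      convert measure_empty (μ := (volume : Measure ℝ))
      ext y
      simp only [Set.mem_preimage, Set.mem_ofPred_eq, Set.mem_empty_iff_false, iff_false]
      rintro ⟨h, h', h''⟩
      exact hx ⟨h, by linarith⟩
  simp_rw [hsec]
  rw [lintegral_indicator measurableSet_Icc, ← ofReal_integral_eq_lintegral_ofReal]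
  · rw [integral_Icc_eq_integral_Ioc, ← intervalIntegral.integral_of_le zero_le_one]
    rw [intervalIntegral.integral_sub (by simp) (by simp)]
    norm_num
  · exact (continuous_const.sub continuous_id).integrableOn_Icc
  · exact (ae_restrict_mem measurableSet_Icc).mono fun x hx => sub_nonneg.2 hx.2

lemma volume_standard_triangle :
    volume {z : Plane | 0 ≤ z 0 ∧ 0 ≤ z 1 ∧ z 0 + z 1 ≤ 1} = ENNReal.ofReal (1 / 2) := by
  rw [← volume_prod_standard_triangle]
  have h := (volume_preserving_finTwoArrow ℝ).comp
    (EuclideanSpace.volume_preserving_symm_measurableEquiv_toLp (Fin 2))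
  rw [← h.measure_preimage_equiv (f := (MeasurableEquiv.toLp 2 (Fin 2 → ℝ)).symm.trans
    MeasurableEquiv.finTwoArrow)]
  rfl

lemma volume_triangle (p q : Plane) :
    volume (triangle p q) = ENNReal.ofReal (|cross p q| / 2) := by
  set L : Plane →ₗ[ℝ] Plane := Matrix.toEuclideanLin !![p 0, q 0; p 1, q 1] with hL
  have hLx (z : Plane) : L z = z 0 • p + z 1 • q := by
    apply Plane.ext
    · simp [hL, Matrix.toLpLin_apply, dotProduct, Fin.sum_univ_two, mul_comm]
    · simp [hL, Matrix.toLpLin_apply, dotProduct, Fin.sum_univ_two, mul_comm]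
  have himg : triangle p q = L '' {z : Plane | 0 ≤ z 0 ∧ 0 ≤ z 1 ∧ z 0 + z 1 ≤ 1} := by
    ext z
    constructor
    · rintro ⟨s, t, hs, ht, hst, rfl⟩
      exact ⟨!₂[s, t], ⟨hs, ht, hst⟩, by simp [hLx]⟩
    · rintro ⟨y, ⟨h0, h1, h2⟩, rfl⟩
      exact ⟨y 0, y 1, h0, h1, h2, hLx y⟩
  have hdet : LinearMap.det L = cross p q := by
    rw [hL, Matrix.toEuclideanLin, Matrix.toLpLin_eq_toLin, LinearMap.det_toLin, Matrix.det_fin_two]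
    simp [cross]; ring
  rw [himg, Measure.addHaar_image_linearMap, volume_standard_triangle, hdet,
    ← ENNReal.ofReal_mul (abs_nonneg _)]
  congr 1; ring

/-! ### Sectors -/

/-- For `a < b < a + π`, the vectors of positive length whose direction angle lies in `[a, b)`,
described as the intersection of two half-planes. -/
def sector (a b : ℝ) : Set Plane :=
  {x | 0 ≤ cross (unitVec a) x ∧ 0 < cross x (unitVec b)}

lemma measurableSet_sector (a b : ℝ) : MeasurableSet (sector a b) := by
  have h0 : Continuous fun x : Plane => cross (unitVec a) x := by unfold cross; fun_prop
  have h1 : Continuous fun x : Plane => cross x (unitVec b) := by unfold cross; fun_prop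
  exact (isClosed_le continuous_const h0).measurableSet.inter
    (isOpen_lt continuous_const h1).measurableSet

lemma smul_unitVec_mem_sector {a b θ ρ : ℝ} (hab : b < a + Real.pi) (hρ : 0 < ρ)
    (hθ : θ ∈ Set.Ico a b) : ρ • unitVec θ ∈ sector a b := by
  constructor
  · rw [cross_smul_right, cross_unitVec]
    exact mul_nonneg hρ.le (Real.sin_nonneg_of_nonneg_of_le_pi (by linarith [hθ.1])
      (by linarith [hθ.2]))
  · rw [cross_smul_left, cross_unitVec]
    exact mul_pos hρ (Real.sin_pos_of_pos_of_lt_pi (by linarith [hθ.2]) (by linarith [hθ.1]))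

lemma exists_of_mem_sector {a b : ℝ} (hlt : a < b) {x : Plane}
    (hx : x ∈ sector a b) : 0 < ‖x‖ ∧ ∃ θ ∈ Set.Ico a b, x = ‖x‖ • unitVec θ := by
  have hpos : 0 < ‖x‖ := by
    rw [norm_pos_iff]
    rintro rfl
    simpa [cross] using hx.2
  obtain ⟨θ, hθ, hxθ⟩ := exists_eq_norm_smul_unitVec_mem_Ico a x
  refine ⟨hpos, θ, ⟨hθ.1, ?_⟩, hxθ⟩
  rw [hxθ] at hx
  obtain ⟨h1, h2⟩ := hx
  rw [cross_smul_right, cross_unitVec] at h1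
  rw [cross_smul_left, cross_unitVec] at h2
  have h1' : 0 ≤ Real.sin (θ - a) := nonneg_of_mul_nonneg_right h1 hpos
  have h2' : 0 < Real.sin (b - θ) := pos_of_mul_pos_right h2 hpos.le
  have h3 : θ - a ≤ Real.pi := by
    by_contra! hc
    have := Real.sin_neg_of_neg_of_neg_pi_lt (x := θ - a - 2 * Real.pi) (by linarith [hθ.2])
      (by linarith)
    rw [Real.sin_sub_two_pi] at this
    linarith
  by_contra! hc
  linarith [Real.sin_nonpos_of_nonpos_of_neg_pi_le (x := b - θ) (by linarith) (by linarith)]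

lemma smul_unitVec_inj {ρ ρ' θ θ' : ℝ} (hρ : 0 < ρ) (hρ' : 0 < ρ')
    (h : ρ • unitVec θ = ρ' • unitVec θ') (hθ : |θ - θ'| < 2 * Real.pi) : θ = θ' := by
  have hn : ρ = ρ' := by
    have := congrArg norm h
    simpa [norm_smul, abs_of_pos hρ, abs_of_pos hρ'] using this
  subst hn
  have hc : Real.cos (θ - θ') = 1 := by
    have h1 := congrArg (fun z => inner ℝ (ρ • unitVec θ') z) h
    simp only [inner_smul_left, inner_smul_right, inner_unitVec, sub_self, Real.cos_zero] at h1
    simpa [hρ.ne'] using h1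
  have := (Real.cos_eq_one_iff_of_lt_of_lt (abs_lt.1 hθ).1 (abs_lt.1 hθ).2).1 hc
  linarith

/-- Sectors over disjoint intervals of `[0, 2π]` are disjoint. -/
lemma disjoint_sector {a b a' b' : ℝ} (ha : 0 ≤ a) (hlt : a < b) (hlt' : a' < b')
    (hb' : b' ≤ 2 * Real.pi) (hd : b ≤ a') : Disjoint (sector a b) (sector a' b') := by
  rw [Set.disjoint_left]
  intro x hx hx'
  obtain ⟨hpos, θ, hθ, h1⟩ := exists_of_mem_sector hlt hx
  obtain ⟨-, θ', hθ', h2⟩ := exists_of_mem_sector hlt' hx'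
  have := smul_unitVec_inj hpos hpos (h1.symm.trans h2)
    (by rw [abs_lt]; constructor <;> linarith [hθ.1, hθ.2, hθ'.1, hθ'.2])
  linarith [hθ.2, hθ'.1]

lemma norm_mul_cos_le_inner_of_mem_sector {a b : ℝ} (hlt : a < b) (hab : b < a + Real.pi)
    {x : Plane} (hx : x ∈ sector a b) :
    ‖x‖ * Real.cos (b - a) ≤ inner ℝ (unitVec a) x := by
  obtain ⟨hpos, θ, hθ, h⟩ := exists_of_mem_sector hlt hx
  have : inner ℝ (unitVec a) x = ‖x‖ * Real.cos (θ - a) := by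
    conv_lhs => rw [h]
    rw [inner_smul_right, inner_unitVec]
  rw [this]
  gcongr
  exact Real.cos_le_cos_of_nonneg_of_le_pi (by linarith [hθ.1]) (by linarith) (by linarith [hθ.2])

lemma abs_cross_le_of_mem_sector {a b : ℝ} (hlt : a < b) {p q : Plane} (hp : p ∈ sector a b)
    (hq : q ∈ sector a b) :
    |cross p q| ≤ ‖p‖ * ‖q‖ * (b - a) := by
  obtain ⟨-, θ, hθ, h⟩ := exists_of_mem_sector hlt hp
  obtain ⟨-, θ', hθ', h'⟩ := exists_of_mem_sector hlt hq
  have : cross p q = ‖p‖ * ‖q‖ * Real.sin (θ' - θ) := by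
    conv_lhs => rw [h, h']
    rw [cross_smul_left, cross_smul_right, cross_unitVec, mul_assoc]
  rw [this, abs_mul, abs_of_nonneg (by positivity)]
  gcongr
  refine Real.abs_sin_le_abs.trans (abs_le.2 ⟨?_, ?_⟩) <;>
    linarith [hθ.1, hθ.2, hθ'.1, hθ'.2]

lemma triangle_subset_insert_sector {a b : ℝ} {p q : Plane} (hp : p ∈ sector a b)
    (hq : q ∈ sector a b) : triangle p q ⊆ insert 0 (sector a b) := by
  rintro z ⟨s, t, hs, ht, -, rfl⟩
  rcases hs.eq_or_lt with rfl | hs'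
  · rcases ht.eq_or_lt with rfl | ht'
    · simp
    · right
      simpa [sector, ht'] using hq
  · right
    simp only [sector, Set.mem_ofPred_eq, cross_add_left, cross_add_right, cross_smul_left,
      cross_smul_right] at hp hq ⊢
    have := mul_pos hs' hp.2
    have := mul_nonneg ht hq.2.le
    have := mul_nonneg hs hp.1
    have := mul_nonneg ht hq.1
    constructor <;> linarith

/-! ### The perimeter of a convex set containing a disk -/

lemma triangle_subset_closure {Ω : Set Plane} (hc : Convex ℝ Ω) (h0 : (0 : Plane) ∈ Ω)
    {p q : Plane} (hp : p ∈ closure Ω) (hq : q ∈ closure Ω) : triangle p q ⊆ closure Ω := by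
  rintro z ⟨s, t, hs, ht, hst, rfl⟩
  have h := hc.closure.sum_mem (t := Finset.univ) (w := ![s, t, 1 - s - t]) (z := ![p, q, 0])
    (by intro i _; fin_cases i <;> simp <;> linarith)
    (by simp [Fin.sum_univ_three])
    (by intro i _; fin_cases i <;> simp [hp, hq, subset_closure h0])
  simpa [Fin.sum_univ_three] using h

/-- The line through two boundary points `p`, `q` in a common narrow sector stays almost as far
away from the centre as the disk of radius `r` contained in the set. Indeed, a point of this line
outside the segment from `p` to `q` cannot lie in the disk, and the points of the segment belong
to the sector. -/
lemma dist_mul_le_abs_cross {Ω : Set Plane} (ho : IsOpen Ω) (hc : Convex ℝ Ω) {r : ℝ}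
    (hr : 0 < r) (hball : Metric.ball 0 r ⊆ Ω) {a b : ℝ} (hlt : a < b)
    (hab : b < a + Real.pi / 2) {p q : Plane} (hp : p ∈ frontier Ω) (hq : q ∈ frontier Ω)
    (hpS : p ∈ sector a b) (hqS : q ∈ sector a b) :
    dist p q * (r * Real.cos (b - a)) ≤ |cross p q| := by
  rcases eq_or_ne p q with rfl | hne
  · simp [cross, mul_comm]
  have hpi := Real.pi_pos
  have hcos : 0 < Real.cos (b - a) :=
    Real.cos_pos_of_mem_Ioo ⟨by linarith, by linarith⟩
  have hpΩ : p ∉ Ω := fun h => (ho.frontier_eq ▸ hp).2 h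
  have hqΩ : q ∉ Ω := fun h => (ho.frontier_eq ▸ hq).2 h
  have hnorm {x : Plane} (hx : x ∉ Ω) : r ≤ ‖x‖ := by
    by_contra! h
    exact hx (hball (by simpa using h))
  set D := q - p with hD
  have hDpos : 0 < ‖D‖ := norm_pos_iff.2 (sub_ne_zero.2 hne.symm)
  -- `h` is the foot of the perpendicular from the origin to the line through `p` and `q`.
  set t := -inner ℝ p D / ‖D‖ ^ 2 with ht
  set h := p + t • D with hh
  have horth : inner ℝ h D = 0 := by
    rw [hh, inner_add_left, inner_smul_left, real_inner_self_eq_norm_sq, ht]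
    simp only [conj_trivial]
    field_simp
    ring
  have hcross : |cross p q| = ‖h‖ * ‖D‖ := by
    have h1 : cross p q = cross h D := by
      simp only [hh, hD, cross, PiLp.add_apply, PiLp.sub_apply, PiLp.smul_apply, smul_eq_mul]
      ring
    have h2 : (cross h D) ^ 2 = (‖h‖ * ‖D‖) ^ 2 := by
      rw [mul_pow, Plane.norm_sq_eq, Plane.norm_sq_eq]
      have : (cross h D) ^ 2 + (inner ℝ h D) ^ 2 =
          (h 0 ^ 2 + h 1 ^ 2) * (D 0 ^ 2 + D 1 ^ 2) := by
        rw [Plane.inner_eq, cross]; ring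
      rw [← this, horth]; ring
    rw [h1, ← sq_eq_sq₀ (abs_nonneg _) (by positivity), sq_abs, h2]
  rw [hcross, dist_comm, dist_eq_norm, ← hD, mul_comm]
  gcongr
  by_contra! hlt'
  have hhΩ : h ∈ interior Ω := by
    rw [ho.interior_eq]
    apply hball
    rw [mem_ball_zero_iff]
    exact hlt'.trans_le (mul_le_of_le_one_right hr.le (Real.cos_le_one _))
  rcases le_or_gt t 0 with ht0 | ht0
  · apply hpΩ
    have := hc.combo_interior_closure_mem_interior hhΩ (frontier_subset_closure hq)
      (a := 1 / (1 - t)) (b := -t / (1 - t)) (one_div_pos.2 (by linarith))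
      (div_nonneg (by linarith) (by linarith)) (by field_simp [show (1 - t) ≠ 0 by linarith]; ring)
    convert interior_subset this using 1
    have h1 : 1 - t ≠ 0 := by linarith
    apply Plane.ext <;> simp [hh, hD] <;> field_simp <;> ring
  rcases le_or_gt 1 t with ht1 | ht1
  · apply hqΩ
    have := hc.combo_interior_closure_mem_interior hhΩ (frontier_subset_closure hp)
      (a := 1 / t) (b := (t - 1) / t) (one_div_pos.2 (by linarith))
      (div_nonneg (by linarith) (by linarith)) (by field_simp; ring)
    convert interior_subset this using 1
    apply Plane.ext <;> simp [hh, hD] <;> field_simp <;> ring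
  have hin {x : Plane} (hx : x ∉ Ω) (hxS : x ∈ sector a b) :
      r * Real.cos (b - a) ≤ inner ℝ (unitVec a) x :=
    (mul_le_mul_of_nonneg_right (hnorm hx) hcos.le).trans
      (norm_mul_cos_le_inner_of_mem_sector hlt (by linarith) hxS)
  have h1 := hin hpΩ hpS
  have h2 := hin hqΩ hqS
  have h3 : inner ℝ (unitVec a) h =
      (1 - t) * inner ℝ (unitVec a) p + t * inner ℝ (unitVec a) q := by
    simp only [hh, hD, inner_add_right, inner_sub_right, inner_smul_right]
    ring
  have h4 : inner ℝ (unitVec a) h ≤ ‖h‖ := by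
    simpa using real_inner_le_norm (unitVec a) h
  nlinarith

/-- The part of the boundary in a narrow sector has diameter at most about `2 / r` times the area
of the part of the set in this sector. -/
lemma ediam_frontier_inter_sector_le {Ω : Set Plane} (ho : IsOpen Ω) (hc : Convex ℝ Ω) {r : ℝ}
    (hr : 0 < r) (hball : Metric.ball 0 r ⊆ Ω) {a b : ℝ} (hlt : a < b)
    (hab : b < a + Real.pi / 2) :
    Metric.ediam (frontier Ω ∩ sector a b) ≤
      ENNReal.ofReal (2 / (r * Real.cos (b - a))) * volume (closure Ω ∩ sector a b) := by
  have hcos : 0 < Real.cos (b - a) :=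
    Real.cos_pos_of_mem_Ioo ⟨by linarith, by linarith⟩
  refine Metric.ediam_le fun p hp q hq => ?_
  have h0 : (0 : Plane) ∈ Ω := hball (by simpa using hr)
  have hsub : triangle p q ⊆ insert 0 (closure Ω ∩ sector a b) := by
    intro z hz
    rcases triangle_subset_insert_sector hp.2 hq.2 hz with h | h
    · exact Or.inl h
    · exact Or.inr ⟨triangle_subset_closure hc h0 (frontier_subset_closure hp.1)
        (frontier_subset_closure hq.1) hz, h⟩
  have hvol : ENNReal.ofReal (|cross p q| / 2) ≤ volume (closure Ω ∩ sector a b) := by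
    rw [← volume_triangle, ← measure_congr (insert_ae_eq_self (0 : Plane) (closure Ω ∩ sector a b))]
    exact measure_mono hsub
  calc edist p q = ENNReal.ofReal (dist p q) := edist_dist p q
    _ ≤ ENNReal.ofReal (2 / (r * Real.cos (b - a)) * (|cross p q| / 2)) := by
        apply ENNReal.ofReal_le_ofReal
        rw [div_mul_div_comm, le_div_iff₀ (by positivity)]
        nlinarith [dist_mul_le_abs_cross ho hc hr hball hlt hab hp.1 hq.1 hp.2 hq.2]
    _ = ENNReal.ofReal (2 / (r * Real.cos (b - a))) * ENNReal.ofReal (|cross p q| / 2) :=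
        ENNReal.ofReal_mul (by positivity)
    _ ≤ _ := by gcongr

/-- A convex set containing a disk of radius `r` has perimeter at most `2 / r` times its area:
the sectors of opening `2π / n` give economical covers of the boundary as `n → ∞`. -/
theorem boundaryLength_le {Ω : Set Plane} (ho : IsOpen Ω) (hc : Convex ℝ Ω)
    (hb : Bornology.IsBounded Ω) {r : ℝ} (hr : 0 < r) (hball : Metric.ball 0 r ⊆ Ω) :
    boundaryLength Ω ≤ ENNReal.ofReal (2 / r) * volume Ω := by
  have hpi := Real.pi_pos
  have h0 : (0 : Plane) ∈ Ω := hball (by simpa using hr)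
  have hvol : volume (closure Ω) = volume Ω :=
    measure_congr (closure_ae_eq_of_null_frontier (hc.addHaar_frontier volume))
  obtain ⟨C, hC, hCΩ⟩ : ∃ C > 0, ∀ x ∈ closure Ω, ‖x‖ ≤ C := by
    obtain ⟨C, hC⟩ := hb.closure.exists_norm_le
    exact ⟨max C 1, by positivity, fun x hx => (hC x hx).trans (le_max_left _ _)⟩
  set δ : ℕ → ℝ := fun n => 2 * Real.pi / n with hδ
  have hδ0 : Filter.Tendsto δ Filter.atTop (nhds 0) :=
    tendsto_const_div_atTop_nhds_zero_nat (2 * Real.pi)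
  have hcos : Filter.Tendsto (fun n => Real.cos (δ n)) Filter.atTop (nhds 1) := by
    have := (Real.continuous_cos.tendsto 0).comp hδ0
    rwa [Real.cos_zero] at this
  set S : (n : ℕ) → Fin n → Set Plane := fun n i => sector (i * δ n) ((i + 1) * δ n) with hS
  have hlarge : ∀ᶠ n : ℕ in Filter.atTop, 5 ≤ n := Filter.eventually_ge_atTop 5
  have hδpos {n : ℕ} (hn : 5 ≤ n) : 0 < δ n := by
    have : (0 : ℝ) < n := by exact_mod_cast (by omega : 0 < n)
    positivity
  have hδlt {n : ℕ} (hn : 5 ≤ n) : δ n < Real.pi / 2 := by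
    have : (5 : ℝ) ≤ n := by exact_mod_cast hn
    rw [hδ, div_lt_iff₀ (by linarith)]
    nlinarith
  have hδn {n : ℕ} (hn : 5 ≤ n) : n * δ n = 2 * Real.pi := by
    have : (n : ℝ) ≠ 0 := by exact_mod_cast (by omega : n ≠ 0)
    rw [hδ]; field_simp
  have hlt {n : ℕ} (hn : 5 ≤ n) (i : Fin n) : (i : ℝ) * δ n < (i + 1) * δ n := by
    linarith [hδpos hn]
  have hdiff (n : ℕ) (i : Fin n) : ((i : ℝ) + 1) * δ n - i * δ n = δ n := by ring
  have hdisj {n : ℕ} (hn : 5 ≤ n) : Pairwise (Function.onFun Disjoint (S n)) := by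
    have key {i j : Fin n} (hij : i < j) : Disjoint (S n i) (S n j) := by
      refine disjoint_sector ?_ (hlt hn i) (hlt hn j) ?_ ?_
      · have := hδpos hn
        positivity
      · rw [← hδn hn]
        gcongr
        exact_mod_cast j.2
      · gcongr
        exact_mod_cast hij
    intro i j hij
    rcases lt_or_gt_of_ne hij with h | h
    · exact key h
    · exact (key h).symm
  have hcover {n : ℕ} (hn : 5 ≤ n) : frontier Ω ⊆ ⋃ i, frontier Ω ∩ S n i := by
    intro x hx
    have hx0 : 0 < ‖x‖ := by
      rw [norm_pos_iff]
      rintro rfl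
      exact (ho.frontier_eq ▸ hx).2 h0
    obtain ⟨θ, hθ, hxθ⟩ := exists_eq_norm_smul_unitVec_mem_Ico 0 x
    have hd := hδpos hn
    have hθ' : 0 ≤ θ / δ n := div_nonneg hθ.1 hd.le
    have hlt' : θ < n * δ n := by rw [hδn hn]; simpa using hθ.2
    have hi : ⌊θ / δ n⌋₊ < n := by
      rw [Nat.floor_lt hθ', div_lt_iff₀ hd]
      exact hlt'
    refine Set.mem_iUnion.2 ⟨⟨⌊θ / δ n⌋₊, hi⟩, hx, ?_⟩
    rw [hxθ]
    refine smul_unitVec_mem_sector ?_ hx0 ⟨?_, ?_⟩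
    · linarith [hδlt hn]
    · exact (le_div_iff₀ hd).1 (Nat.floor_le hθ')
    · exact (div_lt_iff₀ hd).1 (Nat.lt_floor_add_one _)
  have hdiam0 : ∀ᶠ n : ℕ in Filter.atTop, ∀ i : Fin n,
      Metric.ediam (frontier Ω ∩ S n i) ≤
        ENNReal.ofReal (C * C * δ n / (r * Real.cos (δ n))) := by
    filter_upwards [hlarge] with n hn i
    refine Metric.ediam_le fun p hp q hq => ?_
    have hcp : 0 < Real.cos (δ n) := Real.cos_pos_of_mem_Ioo
      ⟨by linarith [hδpos hn], hδlt hn⟩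
    rw [edist_dist]
    apply ENNReal.ofReal_le_ofReal
    have h1 := dist_mul_le_abs_cross ho hc hr hball (hlt hn i)
      (by linarith [hδlt hn]) hp.1 hq.1 hp.2 hq.2
    have h2 := abs_cross_le_of_mem_sector (hlt hn i) hp.2 hq.2
    rw [hdiff] at h1 h2
    rw [le_div_iff₀ (by positivity)]
    refine h1.trans (h2.trans ?_)
    gcongr
    · exact hCΩ p (frontier_subset_closure hp.1)
    · exact hCΩ q (frontier_subset_closure hq.1)
  have hlim0 : Filter.Tendsto (fun n => ENNReal.ofReal (C * C * δ n / (r * Real.cos (δ n))))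
      Filter.atTop (nhds 0) := by
    rw [← ENNReal.ofReal_zero]
    refine (ENNReal.continuous_ofReal.tendsto 0).comp ?_
    have := (hδ0.const_mul (C * C)).div (hcos.const_mul r) (by simpa using hr.ne')
    simpa [Pi.div_def] using this
  have hsum : ∀ᶠ n : ℕ in Filter.atTop,
      ∑ i : Fin n, Metric.ediam (frontier Ω ∩ S n i) ^ (1 : ℝ) ≤
        ENNReal.ofReal (2 / (r * Real.cos (δ n))) * volume Ω := by
    filter_upwards [hlarge] with n hn
    calc ∑ i : Fin n, Metric.ediam (frontier Ω ∩ S n i) ^ (1 : ℝ)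
        ≤ ∑ i : Fin n, ENNReal.ofReal (2 / (r * Real.cos (δ n))) *
            volume (closure Ω ∩ S n i) := by
          refine Finset.sum_le_sum fun i _ => ?_
          rw [ENNReal.rpow_one]
          have := ediam_frontier_inter_sector_le ho hc hr hball (hlt hn i)
            (by linarith [hδlt hn])
          rwa [hdiff] at this
      _ = ENNReal.ofReal (2 / (r * Real.cos (δ n))) *
            volume (⋃ i : Fin n, closure Ω ∩ S n i) := by
          rw [← Finset.mul_sum, measure_iUnion, tsum_fintype]
          · intro i j hij
            exact (hdisj hn hij).mono Set.inter_subset_right Set.inter_subset_right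
          · exact fun i => isClosed_closure.measurableSet.inter (measurableSet_sector _ _)
      _ ≤ _ := by
          rw [← hvol]
          gcongr
          exact Set.iUnion_subset fun i => Set.inter_subset_left
  refine (Measure.hausdorffMeasure_le_liminf_sum 1 (frontier Ω) _ hlim0
    (fun n i => frontier Ω ∩ S n i) hdiam0 (hlarge.mono fun n hn => hcover hn)).trans ?_
  refine (Filter.liminf_le_liminf hsum).trans (le_of_eq ?_)
  apply Filter.Tendsto.liminf_eq
  refine ENNReal.Tendsto.mul_const ?_ (Or.inr hb.measure_lt_top.ne)
  refine (ENNReal.continuous_ofReal.tendsto _).comp ?_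
  have := (tendsto_const_nhds (x := (2 : ℝ))).div (hcos.const_mul r) (by simpa using hr.ne')
  simpa [Pi.div_def] using this

/-! ### Rotationally symmetric sets lie in a regular polygon -/

/-- Invariance under the rotation of angle `α` about the origin, in polar coordinates. -/
def RotationInvariant (α : ℝ) (Ω : Set Plane) : Prop :=
  ∀ ρ θ : ℝ, ρ • unitVec θ ∈ Ω → ρ • unitVec (θ + α) ∈ Ω

lemma RotationInvariant.nat_mul {α : ℝ} {Ω : Set Plane} (h : RotationInvariant α Ω) (k : ℕ) :
    RotationInvariant (k * α) Ω := by
  intro ρ θ hx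
  induction k with
  | zero => simpa using hx
  | succ k ih =>
    have := h ρ _ ih
    rwa [show θ + ((k + 1 : ℕ) : ℝ) * α = θ + k * α + α by push_cast; ring]

/-- The support line is taken through the boundary point nearest to the origin; its distance to the
origin is at most the norm `r` of this point. -/
lemma exists_inscribed_disk_and_support_line {Ω : Set Plane} (ho : IsOpen Ω) (hc : Convex ℝ Ω)
    (hb : Bornology.IsBounded Ω) (h0 : (0 : Plane) ∈ Ω) :
    ∃ r θ : ℝ, 0 < r ∧ Metric.ball 0 r ⊆ Ω ∧ ∀ x ∈ Ω, inner ℝ (unitVec θ) x ≤ r := by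
  have hne : Ωᶜ.Nonempty := by
    rw [Set.nonempty_compl]
    rintro rfl
    exact NormedSpace.unbounded_univ ℝ Plane hb
  obtain ⟨y, hy, hyr⟩ := ho.isClosed_compl.exists_infDist_eq_dist hne (0 : Plane)
  rw [dist_zero_left] at hyr
  have hball : Metric.ball 0 ‖y‖ ⊆ Ω := hyr ▸ Metric.ball_infDist_compl_subset
  have hy0 : 0 < ‖y‖ := by
    rw [norm_pos_iff]
    rintro rfl
    exact hy h0
  obtain ⟨f, hf⟩ := geometric_hahn_banach_open_point hc ho hy
  set a : Plane := (InnerProductSpace.toDual ℝ Plane).symm f with ha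
  have hfa (x : Plane) : f x = inner ℝ a x := by simp [ha]
  have ha0 : 0 < ‖a‖ := by
    rw [norm_pos_iff]
    intro h
    have := hf 0 h0
    simp [hfa, h] at this
  obtain ⟨θ, hθ⟩ := exists_eq_norm_smul_unitVec a
  refine ⟨‖y‖, θ, hy0, hball, fun x hx => ?_⟩
  have h1 := hf x hx
  rw [hfa, hfa] at h1
  have h2 := real_inner_le_norm a y
  have h3 : inner ℝ a x = ‖a‖ * inner ℝ (unitVec θ) x := by
    conv_lhs => rw [hθ]
    rw [inner_smul_left]; simp
  have h4 : ‖a‖ * inner ℝ (unitVec θ) x ≤ ‖a‖ * ‖y‖ := by linarith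
  exact le_of_mul_le_mul_left h4 ha0

/-- Every point of the set belongs to one of the `N` triangles into which the circumscribed regular
polygon is divided by the segments from its centre to its vertices. -/
lemma RotationInvariant.exists_polygon_triangle {N : ℕ} (hN : 0 < N) {Ω : Set Plane}
    (hrot : RotationInvariant (2 * Real.pi / N) Ω) {r θ₀ : ℝ}
    (hsup : ∀ x ∈ Ω, inner ℝ (unitVec θ₀) x ≤ r) {x : Plane} (hx : x ∈ Ω) :
    ∃ k < N, ∃ ψ : ℝ, |ψ| ≤ Real.pi / N ∧
      x = ‖x‖ • unitVec (θ₀ - k * (2 * Real.pi / N) + ψ) ∧ ‖x‖ * Real.cos ψ ≤ r := by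
  have hN' : (0 : ℝ) < N := by exact_mod_cast hN
  have hpi := Real.pi_pos
  set α := 2 * Real.pi / N with hα
  have hα0 : 0 < α := by positivity
  have hNα : N * α = 2 * Real.pi := by rw [hα]; field_simp
  have hhalf : Real.pi / N = α / 2 := by rw [hα]; ring
  obtain ⟨θ, hθ, hxθ⟩ := exists_eq_norm_smul_unitVec_mem_Ico (θ₀ - 2 * Real.pi + α / 2) x
  -- The number of the triangle is the integer nearest to `(θ₀ - θ) / α`.
  set y := (θ₀ - θ) / α + 1 / 2 with hy
  have hyα : y * α = θ₀ - θ + α / 2 := by rw [hy]; field_simp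
  have hy0 : 0 < y := by
    refine pos_of_mul_pos_left ?_ hα0.le
    rw [hyα]; linarith [hθ.2]
  have hyN : y ≤ N := by
    refine le_of_mul_le_mul_right ?_ hα0
    rw [hyα, hNα]; linarith [hθ.1]
  have hk1 : 0 < ⌈y⌉₊ := Nat.ceil_pos.2 hy0
  obtain ⟨k, hk⟩ : ∃ k, ⌈y⌉₊ = k + 1 := ⟨⌈y⌉₊ - 1, by omega⟩
  have hkN : k < N := by
    have : ⌈y⌉₊ ≤ N := Nat.ceil_le.2 hyN
    omega
  have hle : y ≤ k + 1 := by
    have := Nat.le_ceil y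
    rw [hk] at this
    exact_mod_cast this
  have hlt : (k : ℝ) < y := by
    have := Nat.ceil_lt_add_one hy0.le
    rw [hk] at this
    push_cast at this
    linarith
  have h1 : y * α ≤ (k + 1) * α := by gcongr
  have h2 : k * α < y * α := by gcongr
  refine ⟨k, hkN, θ - θ₀ + k * α, ?_, ?_, ?_⟩
  · rw [hhalf, abs_le]
    constructor <;> linarith
  · rw [show θ₀ - k * α + (θ - θ₀ + k * α) = θ by ring]
    exact hxθ
  · have h3 := hsup _ (hrot.nat_mul k ‖x‖ θ (hxθ ▸ hx))
    rw [inner_smul_right, inner_unitVec] at h3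
    rwa [show θ - θ₀ + k * α = θ + k * α - θ₀ by ring]

/-- A point whose direction differs by at most `h` from that of `unitVec β`, and whose component
along `unitVec β` is at most `r`, lies in the isosceles triangle with apex `0`, axis `unitVec β`,
opening `2h` and height `r`. -/
lemma smul_unitVec_mem_triangle {r h : ℝ} (hr : 0 < r) (hh : 0 < h) (hh' : h < Real.pi / 2)
    {β ψ ρ : ℝ} (hψ : |ψ| ≤ h) (hρ : 0 ≤ ρ) (hle : ρ * Real.cos ψ ≤ r) :
    ρ • unitVec (β + ψ) ∈
      triangle ((r / Real.cos h) • unitVec (β - h)) ((r / Real.cos h) • unitVec (β + h)) := by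
  obtain ⟨hψ1, hψ2⟩ := abs_le.1 hψ
  have hcos : 0 < Real.cos h := Real.cos_pos_of_mem_Ioo ⟨by linarith, hh'⟩
  have hsin : 0 < Real.sin h := Real.sin_pos_of_pos_of_lt_pi hh (by linarith)
  have hs1 : 0 ≤ Real.sin (h - ψ) :=
    Real.sin_nonneg_of_nonneg_of_le_pi (by linarith) (by linarith)
  have hs2 : 0 ≤ Real.sin (h + ψ) :=
    Real.sin_nonneg_of_nonneg_of_le_pi (by linarith) (by linarith)
  have hsq := Real.sin_sq_add_cos_sq h
  refine ⟨ρ * Real.sin (h - ψ) / (2 * r * Real.sin h), ρ * Real.sin (h + ψ) / (2 * r * Real.sin h),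
    by positivity, by positivity, ?_, ?_⟩
  · rw [← add_div, div_le_one (by positivity), Real.sin_sub, Real.sin_add]
    nlinarith
  · apply Plane.ext
    · simp only [PiLp.smul_apply, PiLp.add_apply, smul_eq_mul, unitVec_zero, Real.cos_add,
        Real.cos_sub, Real.sin_sub, Real.sin_add]
      field_simp
      ring
    · simp only [PiLp.smul_apply, PiLp.add_apply, smul_eq_mul, unitVec_one, Real.sin_sub, Real.sin_add]
      field_simp
      ring

lemma RotationInvariant.norm_mul_cos_le {N : ℕ} (hN : 2 < N) {Ω : Set Plane}
    (hrot : RotationInvariant (2 * Real.pi / N) Ω) {r θ₀ : ℝ}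
    (hsup : ∀ x ∈ Ω, inner ℝ (unitVec θ₀) x ≤ r) {x : Plane} (hx : x ∈ Ω) :
    ‖x‖ * Real.cos (Real.pi / N) ≤ r := by
  obtain ⟨k, -, ψ, hψ, -, hle⟩ := hrot.exists_polygon_triangle (by omega) hsup hx
  refine le_trans ?_ hle
  gcongr
  rw [← Real.cos_abs ψ]
  refine Real.cos_le_cos_of_nonneg_of_le_pi (abs_nonneg _) ?_ hψ
  exact div_le_self Real.pi_pos.le (by exact_mod_cast (by omega : 1 ≤ N))

lemma RotationInvariant.volume_le {N : ℕ} (hN : 2 < N) {Ω : Set Plane}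
    (hrot : RotationInvariant (2 * Real.pi / N) Ω) {r θ₀ : ℝ} (hr : 0 < r)
    (hsup : ∀ x ∈ Ω, inner ℝ (unitVec θ₀) x ≤ r) :
    volume Ω ≤ ENNReal.ofReal (N * Real.tan (Real.pi / N) * r ^ 2) := by
  have hpi := Real.pi_pos
  have hN' : (2 : ℝ) < N := by exact_mod_cast hN
  set h := Real.pi / N with hh
  have hh0 : 0 < h := by positivity
  have hh2 : h < Real.pi / 2 := by rw [hh]; gcongr
  have hcos : 0 < Real.cos h := Real.cos_pos_of_mem_Ioo ⟨by linarith, hh2⟩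
  have hsin : 0 < Real.sin h := Real.sin_pos_of_pos_of_lt_pi hh0 (by linarith)
  set β : ℕ → ℝ := fun k => θ₀ - k * (2 * Real.pi / N)
  set t : ℕ → Set Plane := fun k =>
    triangle ((r / Real.cos h) • unitVec (β k - h)) ((r / Real.cos h) • unitVec (β k + h)) with ht
  have hsub : Ω ⊆ ⋃ k ∈ Finset.range N, t k := by
    intro x hx
    obtain ⟨k, hk, ψ, hψ, hxψ, hle⟩ := hrot.exists_polygon_triangle (by omega) hsup hx
    refine Set.mem_iUnion₂.2 ⟨k, Finset.mem_range.2 hk, ?_⟩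
    rw [hxψ]
    exact smul_unitVec_mem_triangle hr hh0 hh2 hψ (norm_nonneg _) hle
  have hvol (k : ℕ) : volume (t k) = ENNReal.ofReal (Real.tan h * r ^ 2) := by
    rw [ht, volume_triangle, cross_smul_left, cross_smul_right, cross_unitVec,
      show β k + h - (β k - h) = 2 * h by ring, Real.sin_two_mul, Real.tan_eq_sin_div_cos,
      abs_of_nonneg (by positivity)]
    congr 1
    field_simp
  calc volume Ω ≤ ∑ k ∈ Finset.range N, volume (t k) :=
        (measure_mono hsub).trans (measure_biUnion_finset_le _ _)
    _ = ENNReal.ofReal (N * Real.tan h * r ^ 2) := by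
        simp only [hvol, Finset.sum_const, Finset.card_range, nsmul_eq_mul]
        rw [mul_assoc, ENNReal.ofReal_mul (p := (N : ℝ)) (by positivity), ENNReal.ofReal_natCast]

/-! ### Symmetry axes -/

/-- The orthogonal reflection across the line through the origin of direction angle `α`. -/
noncomputable def mirror (α : ℝ) : Plane ≃ₗᵢ[ℝ] Plane :=
  (ℝ ∙ unitVec α).reflection

lemma mirror_smul_unitVec (α ρ θ : ℝ) :
    mirror α (ρ • unitVec θ) = ρ • unitVec (2 * α - θ) := by
  rw [map_smul, mirror, Submodule.reflection_singleton_apply, inner_unitVec, norm_unitVec]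
  have hsq := Real.sin_sq_add_cos_sq α
  congr 1
  apply Plane.ext
  · simp [Real.cos_sub, Real.cos_two_mul, Real.sin_two_mul]
    ring
  · simp [Real.cos_sub, Real.sin_sub, Real.cos_two_mul, Real.sin_two_mul]
    linear_combination (2 * Real.sin θ) * hsq

/-- Two mirrors at angle `π / N` generate the rotation of angle `2π / N`. -/
lemma rotationInvariant_of_mirrors {α β φ : ℝ} {Ω : Set Plane}
    (hα : ∀ x ∈ Ω, mirror α x ∈ Ω) (hβ : ∀ x ∈ Ω, mirror β x ∈ Ω)
    (hcos : Real.cos (β - α) = Real.cos φ) : RotationInvariant (2 * φ) Ω := by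
  intro ρ θ hx
  obtain ⟨k, hk | hk⟩ := Real.cos_eq_cos_iff.1 hcos
  · have h := hβ _ (hα _ hx)
    rw [mirror_smul_unitVec, mirror_smul_unitVec] at h
    rw [hk, ← unitVec_add_int_mul_two_pi _ (-(2 * k))]
    convert h using 3
    push_cast
    ring
  · have h := hα _ (hβ _ hx)
    rw [mirror_smul_unitVec, mirror_smul_unitVec] at h
    rw [hk, ← unitVec_add_int_mul_two_pi _ (-(2 * k))]
    convert h using 3
    push_cast
    ring

/-- A vector fixed by two mirrors that are not parallel vanishes. -/
lemma eq_zero_of_mirror_fixed {α β : ℝ} (hs : Real.sin (β - α) ≠ 0) {V : Plane}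
    (hα : mirror α V = V) (hβ : mirror β V = V) : V = 0 := by
  rw [mirror, Submodule.reflection_eq_self_iff, Submodule.mem_span_singleton] at hα hβ
  obtain ⟨a, rfl⟩ := hα
  obtain ⟨b, hb⟩ := hβ
  have : cross (a • unitVec α) (unitVec β) = 0 := by
    rw [← hb, cross_smul_left, cross_unitVec]; simp
  rw [cross_smul_left, cross_unitVec] at this
  rw [(mul_eq_zero.1 this).resolve_right hs, zero_smul]

/-- Radial multiples of the position vector have mean zero on a set with two symmetry axes. -/
lemma setIntegral_radial_smul_eq_zero {α β : ℝ} (hs : Real.sin (β - α) ≠ 0) {Ω : Set Plane}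
    (hα : mirror α ⁻¹' Ω = Ω) (hβ : mirror β ⁻¹' Ω = Ω) (w : ℝ → ℝ) :
    ∫ x in Ω, w ‖x‖ • x = 0 := by
  have key {γ : ℝ} (hγ : mirror γ ⁻¹' Ω = Ω) :
      mirror γ (∫ x in Ω, w ‖x‖ • x) = ∫ x in Ω, w ‖x‖ • x := by
    have h1 := (mirror γ).toContinuousLinearEquiv.integral_comp_comm (μ := volume.restrict Ω)
      (fun x : Plane => w ‖x‖ • x)
    have h2 := (mirror γ).measurePreserving.setIntegral_preimage_emb
      (mirror γ).toHomeomorph.measurableEmbedding (fun x => w ‖x‖ • x) Ω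
    rw [hγ] at h2
    simp only [LinearIsometryEquiv.norm_map] at h2
    simp only [LinearIsometryEquiv.coe_toContinuousLinearEquiv, map_smul] at h1
    rw [← h1, h2]
  exact eq_zero_of_mirror_fixed hs (key hα) (key hβ)

/-- The intersection point of two symmetry axes of a convex domain belongs to the domain. -/
lemma zero_mem_of_mirrors {α β : ℝ} (hs : Real.sin (β - α) ≠ 0) {Ω : Set Plane}
    (hΩ : IsConvexDomain Ω) (hα : mirror α ⁻¹' Ω = Ω) (hβ : mirror β ⁻¹' Ω = Ω) :
    (0 : Plane) ∈ Ω := by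
  by_contra h0
  obtain ⟨f, hf⟩ := geometric_hahn_banach_open_point hΩ.convex hΩ.isOpen h0
  have hint : IntegrableOn (fun x : Plane => x) Ω :=
    (continuous_id.continuousOn.integrableOn_compact hΩ.bounded.isCompact_closure).mono_set
      subset_closure
  have hzero : ∫ x in Ω, -f x = 0 := by
    have h1 := setIntegral_radial_smul_eq_zero hs hα hβ (fun _ => 1)
    simp only [one_smul] at h1
    rw [integral_neg, f.integral_comp_comm hint, h1]
    simp
  have hpos : ∀ x ∈ Ω, 0 < -f x := fun x hx => by simpa using hf x hx
  have hlt : 0 < ∫ x in Ω, -f x := by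
    rw [setIntegral_pos_iff_support_of_nonneg_ae
      ((ae_restrict_mem hΩ.isOpen.measurableSet).mono fun x hx => (hpos x hx).le)
      (f.integrable_comp hint).neg]
    refine (hΩ.isOpen.measure_pos volume hΩ.nonempty).trans_le (measure_mono fun x hx => ?_)
    exact ⟨(hpos x hx).ne', hx⟩
  exact hlt.ne' hzero

lemma IsSymmetryAxis.mirror_preimage {L : AffineSubspace ℝ Plane} {Ω : Set Plane}
    (h : IsSymmetryAxis L Ω) {c : Plane} (hc : c ∈ L) {α : ℝ} (hα : unitVec α ∈ L.direction) :
    mirror α ⁻¹' {x | x + c ∈ Ω} = {x | x + c ∈ Ω} := by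
  obtain ⟨hrank, hne, hΩ⟩ := h
  have hdir : L.direction = ℝ ∙ unitVec α := by
    symm
    apply Submodule.eq_of_le_of_finrank_eq
    · rwa [Submodule.span_singleton_le_iff_mem]
    · rw [hrank, finrank_span_singleton]
      rw [← norm_pos_iff, norm_unitVec]
      exact one_pos
  have hrefl (x : Plane) : EuclideanGeometry.reflection L (x + c) = mirror α x + c := by
    rw [EuclideanGeometry.reflection_apply_of_mem L _ hc]
    simp only [vsub_eq_sub, add_sub_cancel_right, vadd_eq_add, mirror]
    congr 1
    simp only [hdir]
  have hmem (y : Plane) (hy : y ∈ Ω) : EuclideanGeometry.reflection L y ∈ Ω :=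
    hΩ ▸ Set.mem_image_of_mem _ hy
  ext x
  simp only [Set.mem_preimage, Set.mem_ofPred_eq]
  constructor
  · intro hx
    have := hmem _ hx
    rwa [← hrefl, EuclideanGeometry.reflection_reflection] at this
  · intro hx
    rw [← hrefl]
    exact hmem _ hx

/-- Normal form of two symmetry axes at angle `φ`: after a translation they become mirrors. -/
lemma exists_center_and_mirrors {L₁ L₂ : AffineSubspace ℝ Plane} {Ω : Set Plane}
    (h₁ : IsSymmetryAxis L₁ Ω) (h₂ : IsSymmetryAxis L₂ Ω) {φ : ℝ} (hφ : LinesFormAngle L₁ L₂ φ)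
    (hs : Real.sin φ ≠ 0) :
    ∃ (c : Plane) (α β : ℝ), Real.cos (β - α) = Real.cos φ ∧ Real.sin (β - α) ≠ 0 ∧
      mirror α ⁻¹' {x | x + c ∈ Ω} = {x | x + c ∈ Ω} ∧
      mirror β ⁻¹' {x | x + c ∈ Ω} = {x | x + c ∈ Ω} := by
  obtain ⟨v, hv, w, hw, hv0, hw0, hang⟩ := hφ
  obtain ⟨α, hα⟩ := exists_eq_norm_smul_unitVec v
  obtain ⟨β, hβ⟩ := exists_eq_norm_smul_unitVec w
  have hα' : unitVec α ∈ L₁.direction := by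
    rw [hα] at hv
    exact (Submodule.smul_mem_iff _ (norm_ne_zero_iff.2 hv0)).1 hv
  have hβ' : unitVec β ∈ L₂.direction := by
    rw [hβ] at hw
    exact (Submodule.smul_mem_iff _ (norm_ne_zero_iff.2 hw0)).1 hw
  have hcos : Real.cos (β - α) = Real.cos φ := by
    rw [← hang, hα, hβ, InnerProductGeometry.angle_smul_left_of_pos _ _ (norm_pos_iff.2 hv0),
      InnerProductGeometry.angle_smul_right_of_pos _ _ (norm_pos_iff.2 hw0),
      InnerProductGeometry.cos_angle]
    simp
  have hsin : Real.sin (β - α) ≠ 0 := by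
    have h1 := Real.sin_sq_add_cos_sq (β - α)
    have h2 := Real.sin_sq_add_cos_sq φ
    rw [hcos] at h1
    have h3 : Real.sin (β - α) ^ 2 = Real.sin φ ^ 2 := by linarith
    intro h4
    rw [h4] at h3
    exact hs (by simpa using h3.symm)
  have hsup : L₁.direction ⊔ L₂.direction = ⊤ := by
    rw [eq_top_iff]
    intro x _
    rw [Submodule.mem_sup]
    refine ⟨(cross x (unitVec β) / Real.sin (β - α)) • unitVec α, Submodule.smul_mem _ _ hα',
      (cross (unitVec α) x / Real.sin (β - α)) • unitVec β, Submodule.smul_mem _ _ hβ', ?_⟩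
    apply Plane.ext
    · simp only [PiLp.add_apply, PiLp.smul_apply, smul_eq_mul]
      field_simp
      simp only [cross, unitVec_zero, unitVec_one, Real.sin_sub]
      ring
    · simp only [PiLp.add_apply, PiLp.smul_apply, smul_eq_mul]
      field_simp
      simp only [cross, unitVec_zero, unitVec_one, Real.sin_sub]
      ring
  obtain ⟨c, hc₁, hc₂⟩ := AffineSubspace.inter_nonempty_of_nonempty_of_sup_direction_eq_top
    (Set.nonempty_coe_sort.1 h₁.2.choose) (Set.nonempty_coe_sort.1 h₂.2.choose) hsup
  exact ⟨c, α, β, hcos, hsin, h₁.mirror_preimage hc₁ hα', h₂.mirror_preimage hc₂ hβ'⟩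

/-! ### Smooth test functions for the Neumann eigenvalue -/

lemma gradient_apply (u : Plane → ℝ) (x : Plane) (i : Fin 2) :
    gradient u x i = fderiv ℝ u x (EuclideanSpace.single i 1) := by
  have h : inner ℝ (gradient u x) (EuclideanSpace.single i (1 : ℝ)) =
      fderiv ℝ u x (EuclideanSpace.single i 1) := by
    rw [gradient, InnerProductSpace.toDual_symm_apply]
  rw [← h, EuclideanSpace.inner_single_right]
  simp

lemma ContDiff.continuous_gradient {u : Plane → ℝ} (hu : ContDiff ℝ 1 u) :
    Continuous (gradient u) :=
  (InnerProductSpace.toDual ℝ Plane).symm.continuous.comp (hu.continuous_fderiv one_ne_zero)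

lemma hasWeakGradient_gradient {Ω : Set Plane} {u : Plane → ℝ} (hu : ContDiff ℝ 1 u) :
    HasWeakGradient Ω u (gradient u) := by
  intro φ hφ hφc hφΩ
  have hφ1 : ContDiff ℝ 1 φ := hφ.of_le (by norm_cast)
  have hgφ : Continuous (gradient φ) := hφ1.continuous_gradient
  have hgu : Continuous (gradient u) := hu.continuous_gradient
  have hfφ := hφ1.continuous_fderiv one_ne_zero
  have hfu := hu.continuous_fderiv one_ne_zero
  have hcgrad : HasCompactSupport (gradient φ) := by
    refine (hφc.fderiv (𝕜 := ℝ)).mono fun x hx h => hx ?_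
    simp only [gradient] at *
    rw [h, map_zero]
  have hsupp_grad : Function.support (fun x => u x • gradient φ x) ⊆ Ω := by
    intro x hx
    refine hφΩ (support_fderiv_subset ℝ fun h => hx ?_)
    simp only [gradient] at *
    rw [h, map_zero, smul_zero]
  have hsupp : Function.support (fun x => φ x • gradient u x) ⊆ Ω := by
    intro x hx
    refine hφΩ (subset_tsupport φ fun h => hx ?_)
    simp only [h, zero_smul]
  rw [setIntegral_eq_integral_of_forall_compl_eq_zero
      (fun x hx => Function.notMem_support.1 fun h => hx (hsupp_grad h)),
    setIntegral_eq_integral_of_forall_compl_eq_zero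
      (fun x hx => Function.notMem_support.1 fun h => hx (hsupp h))]
  have hint1 : Integrable (fun x => u x • gradient φ x) :=
    (hu.continuous.smul hgφ).integrable_of_hasCompactSupport hcgrad.smul_left
  have hint2 : Integrable (fun x => φ x • gradient u x) :=
    (hφ.continuous.smul hgu).integrable_of_hasCompactSupport hφc.smul_right
  ext i
  have h1 := (EuclideanSpace.proj i : Plane →L[ℝ] ℝ).integral_comp_comm hint1
  have h2 := (EuclideanSpace.proj i : Plane →L[ℝ] ℝ).integral_comp_comm hint2
  simp only [PiLp.proj_apply, PiLp.smul_apply, smul_eq_mul, gradient_apply] at h1 h2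
  rw [PiLp.neg_apply, ← h1, ← h2]
  set e : Plane := EuclideanSpace.single i 1
  have hfφe : Continuous fun x => fderiv ℝ φ x e := hfφ.clm_apply continuous_const
  have hfue : Continuous fun x => fderiv ℝ u x e := hfu.clm_apply continuous_const
  have h3 := integral_mul_fderiv_eq_neg_fderiv_mul_of_integrable (μ := (volume : Measure Plane))
    (f := u) (g := φ) (v := e)
    ((hfue.mul hφ.continuous).integrable_of_hasCompactSupport hφc.mul_left)
    ((hu.continuous.mul hfφe).integrable_of_hasCompactSupport
      ((hφc.fderiv_apply (𝕜 := ℝ) e).mul_left))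
    ((hu.continuous.mul hφ.continuous).integrable_of_hasCompactSupport hφc.mul_left)
    (fun x _ => hu.differentiable one_ne_zero x)
    (fun x _ => hφ1.differentiable one_ne_zero x)
  rw [h3]
  simp only [mul_comm]

lemma isH1_gradient {Ω : Set Plane} (hb : Bornology.IsBounded Ω) {u : Plane → ℝ}
    (hu : ContDiff ℝ 1 u) : IsH1 Ω u (gradient u) := by
  have hmem {F : Type} [NormedAddCommGroup F] [NormedSpace ℝ F] [SecondCountableTopology F]
      {f : Plane → F} (hf : Continuous f) : MemLp f 2 (volume.restrict Ω) := by
    obtain ⟨C, hC⟩ := hb.isCompact_closure.exists_bound_of_continuousOn hf.continuousOn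
    have : IsFiniteMeasure (volume.restrict (closure Ω)) :=
      ⟨by simpa using hb.isCompact_closure.measure_lt_top⟩
    have h1 : MemLp f 2 (volume.restrict (closure Ω)) :=
      MemLp.of_bound hf.aestronglyMeasurable C
        ((ae_restrict_mem isClosed_closure.measurableSet).mono hC)
    exact h1.mono_measure (Measure.restrict_mono subset_closure le_rfl)
  exact ⟨hmem hu.continuous, hmem hu.continuous_gradient, hasWeakGradient_gradient hu⟩

lemma bddBelow_neumannRayleighValues (Ω : Set Plane) : BddBelow (neumannRayleighValues Ω) := by
  refine ⟨0, ?_⟩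
  rintro r ⟨u, g, -, -, -, rfl⟩
  positivity

/-- The Rayleigh quotient of a smooth test function bounds the first Neumann eigenvalue. -/
lemma neumannMu1_mul_le {Ω : Set Plane} (hb : Bornology.IsBounded Ω) {u : Plane → ℝ}
    (hu : ContDiff ℝ 1 u) (hmean : ∫ x in Ω, u x = 0) :
    neumannMu1 Ω * ∫ x in Ω, u x ^ 2 ≤ ∫ x in Ω, ‖gradient u x‖ ^ 2 := by
  rcases (show 0 ≤ ∫ x in Ω, u x ^ 2 by positivity).eq_or_lt with h | h
  · rw [← h, mul_zero]; positivity
  · rw [← le_div_iff₀ h]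
    exact csInf_le (bddBelow_neumannRayleighValues Ω) ⟨u, _, isH1_gradient hb hu, hmean, h, rfl⟩

/-- The test function with radial profile `(1 - κ ρ²) ρ`, where `ρ` is the distance to `c`: the
profile times the `i`-th coordinate of the unit vector pointing from `c` to `x`. -/
noncomputable def testFun (κ : ℝ) (c : Plane) (i : Fin 2) (x : Plane) : ℝ :=
  (1 - κ * ‖x - c‖ ^ 2) * (x - c) i

lemma testFun_eq (κ : ℝ) (c : Plane) (i : Fin 2) (x : Plane) :
    testFun κ c i x = (1 - κ * ((x 0 - c 0) ^ 2 + (x 1 - c 1) ^ 2)) * (x i - c i) := by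
  rw [testFun, Plane.norm_sq_eq]; rfl

lemma contDiff_testFun (κ : ℝ) (c : Plane) (i : Fin 2) : ContDiff ℝ 1 (testFun κ c i) := by
  have h : testFun κ c i =
      fun x => (1 - κ * ((x 0 - c 0) ^ 2 + (x 1 - c 1) ^ 2)) * (x i - c i) :=
    funext (testFun_eq κ c i)
  rw [h]
  fun_prop

lemma sum_testFun_sq (κ : ℝ) (c x : Plane) :
    testFun κ c 0 x ^ 2 + testFun κ c 1 x ^ 2 =
      ‖x - c‖ ^ 2 * (1 - κ * ‖x - c‖ ^ 2) ^ 2 := by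
  have h := Plane.norm_sq_eq (x - c)
  simp only [testFun]
  linear_combination (-(1 - κ * ‖x - c‖ ^ 2) ^ 2) * h

lemma gradient_testFun_apply (κ : ℝ) (c : Plane) (i j : Fin 2) (x : Plane) :
    gradient (testFun κ c i) x j =
      (1 - κ * ‖x - c‖ ^ 2) * (if i = j then 1 else 0) - 2 * κ * (x - c) i * (x - c) j := by
  rw [gradient_apply]
  have hcoord (k : Fin 2) : HasFDerivAt (fun y : Plane => (y - c) k)
      (EuclideanSpace.proj k : Plane →L[ℝ] ℝ) x :=
    (EuclideanSpace.proj k : Plane →L[ℝ] ℝ).hasFDerivAt.sub_const (c k)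
  have hnorm := ((hasFDerivAt_id x).sub_const c).norm_sq
  have h := (((hnorm.const_mul κ).const_sub 1).mul (hcoord i)).fderiv
  have h' : testFun κ c i = (fun y => 1 - κ * ‖id y - c‖ ^ 2) * fun y : Plane => (y - c) i := rfl
  rw [h', h]
  simp [EuclideanSpace.inner_single_right]
  ring

lemma sum_norm_gradient_testFun_sq (κ : ℝ) (c x : Plane) :
    ‖gradient (testFun κ c 0) x‖ ^ 2 + ‖gradient (testFun κ c 1) x‖ ^ 2 =
      (1 - κ * ‖x - c‖ ^ 2) ^ 2 + (1 - 3 * κ * ‖x - c‖ ^ 2) ^ 2 := by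
  have h := Plane.norm_sq_eq (x - c)
  rw [Plane.norm_sq_eq, Plane.norm_sq_eq]
  simp only [gradient_testFun_apply]
  rw [h]
  simp
  ring

/-! ### Comparison with the disk of equal area -/

/-- The defect `∑ |∇uᵢ|² - λ ∑ uᵢ²` of the two test functions as a function of `s = ρ²`, where
`S = R²` is the squared radius of the reference disk, `κ = (2 / 7) / S` and `λ = (332 / 97) / S`.
The constant `332 / 97` is the one for which the integral of the defect over the disk vanishes. -/
noncomputable def defect (S s : ℝ) : ℝ :=
  (1 - 2 / 7 / S * s) ^ 2 + (1 - 3 * (2 / 7 / S) * s) ^ 2 -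
    332 / 97 / S * (s * (1 - 2 / 7 / S * s) ^ 2)

lemma continuous_defect (S : ℝ) : Continuous (defect S) := by
  unfold defect; fun_prop

/-- The quadratic cofactor of the root `t = 1` of `defect 1 t - defect 1 1`. -/
lemma defect_sub_defect {S : ℝ} (hS : 0 < S) (t : ℝ) :
    defect S (S * t) - defect S S =
      (t - 1) * (-(1328 / 4753) * t ^ 2 + 11848 / 4753 * t - 15284 / 4753) := by
  unfold defect
  field_simp
  ring

lemma defect_le_of_le {S s : ℝ} (hS : 0 < S) (h0 : 0 ≤ s) (h : s ≤ S) :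
    defect S S ≤ defect S s := by
  obtain ⟨t, rfl⟩ : ∃ t, s = S * t := ⟨s / S, by field_simp⟩
  have ht0 : 0 ≤ t := nonneg_of_mul_nonneg_right h0 hS
  have ht1 : t ≤ 1 := by nlinarith
  rw [← sub_nonneg, defect_sub_defect hS]
  apply mul_nonneg_of_nonpos_of_nonpos <;> nlinarith

lemma le_defect_of_le {S s : ℝ} (hS : 0 < S) (h : S ≤ s) (h' : s ≤ 1.53 * S) :
    defect S s ≤ defect S S := by
  obtain ⟨t, rfl⟩ : ∃ t, s = S * t := ⟨s / S, by field_simp⟩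
  have ht0 : 1 ≤ t := by nlinarith
  have ht1 : t ≤ 1.53 := by nlinarith
  rw [← sub_nonpos, defect_sub_defect hS]
  apply mul_nonpos_of_nonneg_of_nonpos
  · linarith
  · norm_num at ht1
    nlinarith [mul_nonneg (sub_nonneg.2 ht0) (sub_nonneg.2 ht1)]

lemma integral_ball_defect {R : ℝ} (hR : 0 < R) :
    ∫ x in Metric.ball (0 : Plane) R, defect (R ^ 2) (‖x‖ ^ 2) = 0 := by
  have h1 : ∫ x in Metric.ball (0 : Plane) R, defect (R ^ 2) (‖x‖ ^ 2) =
      ∫ x : Plane, (Set.Iio R).indicator (fun y => defect (R ^ 2) (y ^ 2)) ‖x‖ := by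
    rw [← integral_indicator measurableSet_ball]
    congr 1
    ext x
    by_cases h : ‖x‖ < R
    · rw [Set.indicator_of_mem (mem_ball_zero_iff.2 h), Set.indicator_of_mem (Set.mem_Iio.2 h)]
    · rw [Set.indicator_of_notMem (mt mem_ball_zero_iff.1 h), Set.indicator_of_notMem (mt Set.mem_Iio.1 h)]
  have h2 : ∫ y in Set.Ioi (0 : ℝ), y ^ (Module.finrank ℝ Plane - 1) •
      (Set.Iio R).indicator (fun y => defect (R ^ 2) (y ^ 2)) y =
      ∫ y in (0 : ℝ)..R, y * defect (R ^ 2) (y ^ 2) := by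
    rw [intervalIntegral.integral_of_le hR.le, integral_Ioc_eq_integral_Ioo,
      ← Set.Ioi_inter_Iio, ← setIntegral_indicator measurableSet_Iio]
    congr 1
    ext y
    simp [Set.indicator_apply]
  have h3 (y : ℝ) : HasDerivAt (fun y => y ^ 2 - 2 / 7 / R ^ 2 * (2 * y ^ 4) +
      (2 / 7 / R ^ 2) ^ 2 * (10 / 6 * y ^ 6) - 332 / 97 / R ^ 2 * (y ^ 4 / 4 -
        2 / 7 / R ^ 2 * (y ^ 6 / 3) + (2 / 7 / R ^ 2) ^ 2 * (y ^ 8 / 8)))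
      (y * defect (R ^ 2) (y ^ 2)) y := by
    have hp (n : ℕ) := hasDerivAt_pow n y
    refine HasDerivAt.congr_deriv ((((hp 2).sub (((hp 4).const_mul 2).const_mul _)).add
      (((hp 6).const_mul (10 / 6)).const_mul _)).sub (((((hp 4).div_const 4).sub
        (((hp 6).div_const 3).const_mul _)).add (((hp 8).div_const 8).const_mul _)).const_mul _)) ?_
    unfold defect
    push_cast
    ring
  rw [h1, integral_fun_norm_addHaar, h2,
    intervalIntegral.integral_eq_sub_of_hasDerivAt (fun y _ => h3 y)]
  · have : R ^ 2 - 2 / 7 / R ^ 2 * (2 * R ^ 4) +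
      (2 / 7 / R ^ 2) ^ 2 * (10 / 6 * R ^ 6) - 332 / 97 / R ^ 2 * (R ^ 4 / 4 -
        2 / 7 / R ^ 2 * (R ^ 6 / 3) + (2 / 7 / R ^ 2) ^ 2 * (R ^ 8 / 8)) = 0 := by
      field_simp
      ring
    rw [this]
    simp
  · exact (continuous_id.mul ((continuous_defect _).comp (continuous_pow 2))).intervalIntegrable _ _

/-- Mass transplantation: among sets of the area of the disk of radius `R` that are contained in
a slightly larger disk, the integral of the defect is largest for the disk. -/
lemma setIntegral_defect_nonpos {Ω : Set Plane} (hm : MeasurableSet Ω)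
    (hb : Bornology.IsBounded Ω) {R : ℝ} (hR : 0 < R)
    (hvol : volume.real Ω = Real.pi * R ^ 2) (hΩ : ∀ x ∈ Ω, ‖x‖ ^ 2 ≤ 1.53 * R ^ 2) :
    ∫ x in Ω, defect (R ^ 2) (‖x‖ ^ 2) ≤ 0 := by
  have hcont : Continuous fun x : Plane => defect (R ^ 2) (‖x‖ ^ 2) :=
    (continuous_defect _).comp (continuous_norm.pow 2)
  have hint {T : Set Plane} (hT : Bornology.IsBounded T) {f : Plane → ℝ} (hf : Continuous f) :
      IntegrableOn f T :=
    (hf.continuousOn.integrableOn_compact hT.isCompact_closure).mono_set subset_closure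
  have hB : Bornology.IsBounded (Metric.ball (0 : Plane) R) := Metric.isBounded_ball
  have hvolB : volume.real (Metric.ball (0 : Plane) R) = Real.pi * R ^ 2 := by
    rw [Measure.real, EuclideanSpace.volume_ball_fin_two, ← ENNReal.ofReal_pow hR.le,
      ← ENNReal.ofReal_mul (by positivity), ENNReal.toReal_ofReal (by positivity), mul_comm]
  set D := defect (R ^ 2) (R ^ 2)
  have hsub {T : Set Plane} (hT : Bornology.IsBounded T) :
      ∫ x in T, (defect (R ^ 2) (‖x‖ ^ 2) - D) =
        (∫ x in T, defect (R ^ 2) (‖x‖ ^ 2)) - volume.real T * D := by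
    rw [integral_sub (hint hT hcont) (hint hT continuous_const), setIntegral_const, smul_eq_mul]
  have hle : ∫ x in Ω, (defect (R ^ 2) (‖x‖ ^ 2) - D) ≤
      ∫ x in Metric.ball (0 : Plane) R, (defect (R ^ 2) (‖x‖ ^ 2) - D) := by
    rw [← integral_indicator hm, ← integral_indicator measurableSet_ball]
    refine integral_mono ((integrable_indicator_iff hm).2 (hint hb (hcont.sub continuous_const)))
      ((integrable_indicator_iff measurableSet_ball).2 (hint hB (hcont.sub continuous_const)))
      fun x => ?_
    by_cases hxB : x ∈ Metric.ball (0 : Plane) R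
    · have h1 : 0 ≤ defect (R ^ 2) (‖x‖ ^ 2) - D := by
        rw [mem_ball_zero_iff] at hxB
        exact sub_nonneg.2 (defect_le_of_le (by positivity) (by positivity) (by gcongr))
      rw [Set.indicator_of_mem hxB]
      exact Set.indicator_le_self' (fun _ _ => h1) x
    · rw [Set.indicator_of_notMem hxB]
      rw [mem_ball_zero_iff, not_lt] at hxB
      refine Set.indicator_apply_le' (fun hx => ?_) fun _ => le_rfl
      exact sub_nonpos.2 (le_defect_of_le (by positivity) (by gcongr) (hΩ x hx))
  rw [hsub hb, hsub hB, integral_ball_defect hR, hvol, hvolB] at hle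
  linarith

/-! ### The numerical estimate for the regular polygon -/

/-- Passing to the half angle makes the elementary bounds for sine and cosine sharp enough. -/
lemma sin_le_mul_cos {x : ℝ} (h0 : 0 ≤ x) (h : x ≤ Real.pi / 5) :
    Real.sin x ≤ 1.168 * x * Real.cos x := by
  obtain ⟨y, rfl⟩ : ∃ y, x = 2 * y := ⟨x / 2, by ring⟩
  have hy0 : 0 ≤ y := by linarith
  have hy : y ≤ 0.31416 := by linarith [Real.pi_lt_d4]
  norm_num at hy
  have hz : y ^ 2 ≤ 0.0987 := by norm_num; nlinarith
  norm_num at hz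
  have hs : Real.sin y ≤ y * (1 - 3 / 20 * y ^ 2) := by
    have h1 := (abs_le.1 (Real.sin_bound (x := y) (by rw [abs_of_nonneg hy0]; linarith))).2
    rw [abs_of_nonneg hy0] at h1
    nlinarith [pow_nonneg hy0 3, mul_le_mul_of_nonneg_left hy (pow_nonneg hy0 3)]
  have hc : 1 - y ^ 2 / 2 ≤ Real.cos y := Real.one_sub_sq_div_two_le_cos
  obtain ⟨d, hd⟩ : ∃ d, Real.cos y = 1 - y ^ 2 / 2 + d := ⟨_, (add_sub_cancel _ _).symm⟩
  have hd0 : 0 ≤ d := by linarith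
  have hcpos : 0 ≤ Real.cos y := by linarith
  have key : (1 - 3 / 20 * y ^ 2) * Real.cos y ≤ 1.168 * (2 * Real.cos y ^ 2 - 1) := by
    rw [hd]
    set z := y ^ 2
    have hz0 : 0 ≤ z := by positivity
    norm_num
    nlinarith [mul_nonneg hd0 (sub_nonneg.2 hz), mul_nonneg hd0 hz0, sq_nonneg d, sq_nonneg z]
  rw [Real.sin_two_mul, Real.cos_two_mul]
  calc 2 * Real.sin y * Real.cos y ≤ 2 * (y * (1 - 3 / 20 * y ^ 2)) * Real.cos y := by gcongr
    _ = 2 * y * ((1 - 3 / 20 * y ^ 2) * Real.cos y) := by ring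
    _ ≤ 2 * y * (1.168 * (2 * Real.cos y ^ 2 - 1)) := by gcongr
    _ = _ := by ring

lemma cos_pi_div_five_ge : (0.809 : ℝ) ≤ Real.cos (Real.pi / 5) := by
  rw [Real.cos_pi_div_five]
  have : (2.236 : ℝ) ≤ √5 := Real.le_sqrt_of_sq_le (by norm_num)
  norm_num at this ⊢
  linarith

lemma natCast_mul_tan_lt {N : ℕ} (hN : 5 ≤ N) :
    332 / 97 * (N * Real.tan (Real.pi / N)) < 4 * Real.pi := by
  have hN' : (5 : ℝ) ≤ N := by exact_mod_cast hN
  have hpi := Real.pi_pos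
  have h0 : 0 ≤ Real.pi / N := by positivity
  have h5 : Real.pi / N ≤ Real.pi / 5 := by gcongr
  have hcos : 0 < Real.cos (Real.pi / N) :=
    Real.cos_pos_of_mem_Ioo ⟨by linarith, by linarith⟩
  have h1 : Real.tan (Real.pi / N) ≤ 1.168 * (Real.pi / N) := by
    rw [Real.tan_eq_sin_div_cos, div_le_iff₀ hcos]
    exact sin_le_mul_cos h0 h5
  have h2 : N * Real.tan (Real.pi / N) ≤ 1.168 * Real.pi := by
    calc N * Real.tan (Real.pi / N) ≤ N * (1.168 * (Real.pi / N)) := by gcongr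
      _ = 1.168 * Real.pi := by field_simp
  norm_num at h2
  linarith

/-! ### The eigenvalue estimate and the conclusion -/

lemma setIntegral_comp_sub {F : Type*} [NormedAddCommGroup F] [NormedSpace ℝ F] (Ω : Set Plane)
    (c : Plane) (f : Plane → F) :
    ∫ x in Ω, f (x - c) = ∫ x in {x | x + c ∈ Ω}, f x := by
  have h := (measurePreserving_sub_right volume c).setIntegral_preimage_emb
    (MeasurableEquiv.subRight c).measurableEmbedding f {x | x + c ∈ Ω}
  rwa [show (fun x => x - c) ⁻¹' {x | x + c ∈ Ω} = Ω by ext x; simp] at h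

/-- A bounded set of area `π R²`, contained in a slightly larger disk than the one of radius `R`
about its centre of symmetry `c`, satisfies `μ₁ ≤ (332 / 97) / R²`: this is the sum of the Rayleigh
estimates for the two test functions. -/
lemma neumannMu1_le {Ω : Set Plane} (ho : IsOpen Ω) (hne : Ω.Nonempty)
    (hb : Bornology.IsBounded Ω) {c : Plane}
    (hmean : ∀ w : ℝ → ℝ, ∫ x in {x | x + c ∈ Ω}, w ‖x‖ • x = 0) {R : ℝ} (hR : 0 < R)
    (hvol : volume.real {x | x + c ∈ Ω} = Real.pi * R ^ 2)
    (hΩ : ∀ x, x + c ∈ Ω → ‖x‖ ^ 2 ≤ 1.53 * R ^ 2) :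
    neumannMu1 Ω ≤ 332 / 97 / R ^ 2 := by
  set Ω' : Set Plane := {x | x + c ∈ Ω} with hΩ'
  have ho' : IsOpen Ω' := ho.preimage (continuous_id.add continuous_const)
  have hb' : Bornology.IsBounded Ω' := by
    refine (Metric.isBounded_closedBall (x := (0 : Plane)) (r := 1.53 * R ^ 2 + 1)).subset
      fun x hx => ?_
    rw [mem_closedBall_zero_iff]
    nlinarith [hΩ x hx, sq_nonneg (‖x‖ - 1)]
  have hint {f : Plane → ℝ} (hf : Continuous f) {T : Set Plane} (hT : Bornology.IsBounded T) :
      IntegrableOn f T :=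
    (hf.continuousOn.integrableOn_compact hT.isCompact_closure).mono_set subset_closure
  set κ := 2 / 7 / R ^ 2 with hκ
  have hcont (i : Fin 2) : Continuous (testFun κ c i) := (contDiff_testFun κ c i).continuous
  have hgrad (i : Fin 2) : Continuous (gradient (testFun κ c i)) :=
    (contDiff_testFun κ c i).continuous_gradient
  have hmean' (i : Fin 2) : ∫ x in Ω, testFun κ c i x = 0 := by
    have h1 := setIntegral_comp_sub Ω c fun x => (1 - κ * ‖x‖ ^ 2) * x i
    have hcontw : Continuous fun x : Plane => (1 - κ * ‖x‖ ^ 2) • x := by fun_prop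
    have hintw : IntegrableOn (fun x : Plane => (1 - κ * ‖x‖ ^ 2) • x) Ω' :=
      (hcontw.continuousOn.integrableOn_compact hb'.isCompact_closure).mono_set subset_closure
    have h2 := (EuclideanSpace.proj i : Plane →L[ℝ] ℝ).integral_comp_comm hintw
    rw [hmean fun ρ => 1 - κ * ρ ^ 2, map_zero] at h2
    exact h1.trans h2
  have hray (i : Fin 2) := neumannMu1_mul_le hb (contDiff_testFun κ c i) (hmean' i)
  have hden : (∫ x in Ω, testFun κ c 0 x ^ 2) + ∫ x in Ω, testFun κ c 1 x ^ 2 =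
      ∫ x in Ω', ‖x‖ ^ 2 * (1 - κ * ‖x‖ ^ 2) ^ 2 := by
    have hi (i : Fin 2) : IntegrableOn (fun x => testFun κ c i x ^ 2) Ω :=
      hint ((hcont i).pow 2) hb
    rw [← integral_add (hi 0) (hi 1),
      ← setIntegral_comp_sub Ω c fun x => ‖x‖ ^ 2 * (1 - κ * ‖x‖ ^ 2) ^ 2]
    simp only [sum_testFun_sq]
  have hnum : (∫ x in Ω, ‖gradient (testFun κ c 0) x‖ ^ 2) +
      ∫ x in Ω, ‖gradient (testFun κ c 1) x‖ ^ 2 =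
      ∫ x in Ω', ((1 - κ * ‖x‖ ^ 2) ^ 2 + (1 - 3 * κ * ‖x‖ ^ 2) ^ 2) := by
    have hi (i : Fin 2) : IntegrableOn (fun x => ‖gradient (testFun κ c i) x‖ ^ 2) Ω :=
      hint ((hgrad i).norm.pow 2) hb
    rw [← integral_add (hi 0) (hi 1),
      ← setIntegral_comp_sub Ω c fun x => (1 - κ * ‖x‖ ^ 2) ^ 2 + (1 - 3 * κ * ‖x‖ ^ 2) ^ 2]
    simp only [sum_norm_gradient_testFun_sq]
  have hintnum : IntegrableOn (fun x : Plane => (1 - κ * ‖x‖ ^ 2) ^ 2 +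
      (1 - 3 * κ * ‖x‖ ^ 2) ^ 2) Ω' := hint (by fun_prop) hb'
  have hintden : IntegrableOn (fun x : Plane => ‖x‖ ^ 2 * (1 - κ * ‖x‖ ^ 2) ^ 2) Ω' :=
    hint (by fun_prop) hb'
  have hdef : (∫ x in Ω', ((1 - κ * ‖x‖ ^ 2) ^ 2 + (1 - 3 * κ * ‖x‖ ^ 2) ^ 2)) -
      332 / 97 / R ^ 2 * ∫ x in Ω', ‖x‖ ^ 2 * (1 - κ * ‖x‖ ^ 2) ^ 2 ≤ 0 := by
    rw [← integral_const_mul, ← integral_sub hintnum (hintden.const_mul _)]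
    exact setIntegral_defect_nonpos ho'.measurableSet hb' hR hvol hΩ
  have hnumpos : 0 < ∫ x in Ω', ((1 - κ * ‖x‖ ^ 2) ^ 2 + (1 - 3 * κ * ‖x‖ ^ 2) ^ 2) := by
    have hpos (x : Plane) : 0 < (1 - κ * ‖x‖ ^ 2) ^ 2 + (1 - 3 * κ * ‖x‖ ^ 2) ^ 2 := by
      nlinarith [sq_nonneg (1 - κ * ‖x‖ ^ 2), sq_nonneg (1 - 3 * κ * ‖x‖ ^ 2),
        sq_nonneg (5 * κ * ‖x‖ ^ 2 - 2)]
    rw [setIntegral_pos_iff_support_of_nonneg_ae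
      (Filter.Eventually.of_forall fun x => (hpos x).le) hintnum]
    obtain ⟨y, hy⟩ := hne
    refine (ho'.measure_pos volume ⟨y - c, by simpa [hΩ'] using hy⟩).trans_le
      (measure_mono fun x hx => ⟨(hpos x).ne', hx⟩)
  have hdenpos : 0 < ∫ x in Ω', ‖x‖ ^ 2 * (1 - κ * ‖x‖ ^ 2) ^ 2 := by
    refine pos_of_mul_pos_right (a := 332 / 97 / R ^ 2) ?_ (by positivity)
    linarith
  have hsum : neumannMu1 Ω * ∫ x in Ω', ‖x‖ ^ 2 * (1 - κ * ‖x‖ ^ 2) ^ 2 ≤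
      332 / 97 / R ^ 2 * ∫ x in Ω', ‖x‖ ^ 2 * (1 - κ * ‖x‖ ^ 2) ^ 2 := by
    rw [← hden] at hdef ⊢
    rw [← hnum] at hdef
    linarith [hray 0, hray 1]
  exact le_of_mul_le_mul_right hsum hdenpos

lemma boundaryLength_translate (Ω : Set Plane) (c : Plane) :
    boundaryLength {x | x + c ∈ Ω} = boundaryLength Ω := by
  have h : {x | x + c ∈ Ω} = (IsometryEquiv.addRight c).toHomeomorph ⁻¹' Ω := rfl
  rw [boundaryLength, h, ← Homeomorph.preimage_frontier]
  exact (IsometryEquiv.addRight c).hausdorffMeasure_preimage 1 (frontier Ω)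

lemma IsConvexDomain.translate {Ω : Set Plane} (hΩ : IsConvexDomain Ω) (c : Plane) :
    IsConvexDomain {x | x + c ∈ Ω} where
  nonempty := by
    obtain ⟨y, hy⟩ := hΩ.nonempty
    exact ⟨y - c, by simpa using hy⟩
  isOpen := hΩ.isOpen.preimage (continuous_id.add continuous_const)
  bounded := (IsometryEquiv.addRight c).isometry.antilipschitz.isBounded_preimage hΩ.bounded
  convex := hΩ.convex.translate_preimage_left c

theorem mainTheorem5 (N : ℕ) (hN : 5 ≤ N) (Ω : Set Plane) (hΩ : IsConvexDomain Ω)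
    (L₁ L₂ : AffineSubspace ℝ Plane) (h₁ : IsSymmetryAxis L₁ Ω) (h₂ : IsSymmetryAxis L₂ Ω)
    (hangle : LinesFormAngle L₁ L₂ (Real.pi / N)) :
    boundaryLength Ω ≠ ⊤ ∧ perimeter Ω ^ 2 * neumannMu1 Ω < 16 * Real.pi ^ 2 := by
  have hpi := Real.pi_pos
  have hN' : (5 : ℝ) ≤ N := by exact_mod_cast hN
  have hφ0 : 0 < Real.pi / N := by positivity
  have hφ5 : Real.pi / N ≤ Real.pi / 5 := by gcongr
  obtain ⟨c, α, β, hcos, hsin, hα, hβ⟩ := exists_center_and_mirrors h₁ h₂ hangle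
    (Real.sin_pos_of_pos_of_lt_pi hφ0 (by linarith)).ne'
  set Ω' : Set Plane := {x | x + c ∈ Ω} with hΩ'
  have hconv : IsConvexDomain Ω' := hΩ.translate c
  have hrot : RotationInvariant (2 * Real.pi / N) Ω' := by
    rw [mul_div_assoc]
    exact rotationInvariant_of_mirrors (fun x hx => hα.ge hx) (fun x hx => hβ.ge hx) hcos
  obtain ⟨r, θ₀, hr, hball, hsup⟩ := exists_inscribed_disk_and_support_line hconv.isOpen
    hconv.convex hconv.bounded (zero_mem_of_mirrors hsin hconv hα hβ)
  have hfin : volume Ω' ≠ ⊤ := hconv.bounded.measure_lt_top.ne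
  set A := volume.real Ω' with hA
  have hAofReal : volume Ω' = ENNReal.ofReal A := (ENNReal.ofReal_toReal hfin).symm
  -- The reference disk has the area of the domain; its radius is at least the inradius `r`.
  set R := √(A / Real.pi) with hR
  have hrA : Real.pi * r ^ 2 ≤ A := by
    have h := ENNReal.toReal_mono hfin (measure_mono hball)
    rw [EuclideanSpace.volume_ball_fin_two, ENNReal.toReal_mul, ENNReal.toReal_pow,
      ENNReal.toReal_ofReal hr.le, ENNReal.toReal_ofReal hpi.le, mul_comm] at h
    exact h
  have hApos : 0 < A := lt_of_lt_of_le (by positivity) hrA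
  have hRpos : 0 < R := Real.sqrt_pos.2 (by positivity)
  have hR2 : Real.pi * R ^ 2 = A := by
    rw [hR, Real.sq_sqrt (by positivity)]; field_simp
  have hrR : r ^ 2 ≤ R ^ 2 := by
    refine le_of_mul_le_mul_left ?_ hpi
    rwa [hR2]
  have hfar : ∀ x ∈ Ω', ‖x‖ ^ 2 ≤ 1.53 * R ^ 2 := by
    intro x hx
    have h1 := hrot.norm_mul_cos_le (by omega) hsup hx
    have h2 : (0.809 : ℝ) ≤ Real.cos (Real.pi / N) := cos_pi_div_five_ge.trans
      (Real.cos_le_cos_of_nonneg_of_le_pi hφ0.le (by linarith) hφ5)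
    have h3 : ‖x‖ * 0.809 ≤ r := le_trans (by gcongr) h1
    have h4 : (‖x‖ * 0.809) ^ 2 ≤ r ^ 2 := by gcongr
    norm_num at h4 ⊢
    nlinarith [sq_nonneg ‖x‖]
  have hmu : neumannMu1 Ω ≤ 332 / 97 / R ^ 2 :=
    neumannMu1_le hΩ.isOpen hΩ.nonempty hΩ.bounded (setIntegral_radial_smul_eq_zero hsin hα hβ)
      hRpos hR2.symm hfar
  have hlen : boundaryLength Ω ≤ ENNReal.ofReal (2 / r * A) := by
    rw [← boundaryLength_translate Ω c, ENNReal.ofReal_mul (by positivity), ← hAofReal]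
    exact boundaryLength_le hconv.isOpen hconv.convex hconv.bounded hr hball
  have hper : perimeter Ω ≤ 2 / r * A := ENNReal.toReal_le_of_le_ofReal (by positivity) hlen
  have harea : A ≤ N * Real.tan (Real.pi / N) * r ^ 2 := by
    have htan : 0 ≤ Real.tan (Real.pi / N) :=
      Real.tan_nonneg_of_nonneg_of_le_pi_div_two hφ0.le (by linarith)
    exact ENNReal.toReal_le_of_le_ofReal (by positivity) (hrot.volume_le (by omega) hr hsup)
  refine ⟨ne_top_of_le_ne_top ENNReal.ofReal_ne_top hlen, ?_⟩
  have hper0 : 0 ≤ perimeter Ω := ENNReal.toReal_nonneg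
  calc perimeter Ω ^ 2 * neumannMu1 Ω ≤ (2 / r * A) ^ 2 * (332 / 97 / R ^ 2) := by
        refine (mul_le_mul_of_nonneg_left hmu (by positivity)).trans ?_
        gcongr
    _ = 4 * Real.pi * (332 / 97 * (A / r ^ 2)) := by
        rw [← hR2]; field_simp; ring
    _ ≤ 4 * Real.pi * (332 / 97 * (N * Real.tan (Real.pi / N))) := by
        gcongr
        rwa [div_le_iff₀ (by positivity)]
    _ < 4 * Real.pi * (4 * Real.pi) := by
        exact mul_lt_mul_of_pos_left (natCast_mul_tan_lt hN) (by positivity)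
    _ = 16 * Real.pi ^ 2 := by ring
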